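/- Let $\alpha\ge -1$ be a real number. For integers $n,k\ge 0$ put $$B_{n,k}=\binom{n+\alpha}{n-k}\frac{n!}{k!}\quad(0\le k\le n),\qquad B_{n,k}=0\quad(k>n),$$ where $\binom{x}{m}=x(x-1)\cdots(x-m+1)/m!$ for real $x$. Let $L^{(\alpha)}_n(q)=\sum_{k=0}^n B_{n,k}(-q)^k$ be the Laguerre polynomials, $\widetilde L^{(\alpha)}_n(q)=L^{(\alpha)}_n(-q)=\sum_{k=0}^n B_{n,k}q^k$ the signless Laguerre polynomials, and $\widetilde L^{(\alpha)*}_n(q)=q^n\widetilde L^{(\alpha)}_n(1/q)$ their reciprocal polynomials. A sequence $(a_n(q))_{n\ge0}$ in $\mathbb{R}[q]$ is called $q$-Stieltjes moment if every minor of its infinite Hankel matrix $[a_{i+j}(q)]_{i,j\ge0}$ is a polynomial in $q$ with nonnegative coefficients. Let $\mathcal L$ be the operator that sends a sequence $(a_i)$ to the sequence $\mathcal L[a_i]=a_{i-1}a_{i+1}-a_i^2$, defined for those $i$ for which $a_{i-1}$ is defined (so $\mathcal L^m[a_i]$ is defined for $i\ge m$). The sequence is called $3$-$q$-log-convex if $\mathcal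 L^m[a_i]$ has nonnegative coefficients for all $0\le m\le 3$ and all $i\ge m$. A real sequence $(x_n)_{n\ge0}$ is a Stieltjes moment sequence if there is a nonnegative measure $\mu$ on $[0,\infty)$ with $x_n=\int_0^\infty t^n\,d\mu(t)$ (the integral being finite) for all $n\ge0$. Then: (i) both $(\widetilde L^{(\alpha)}_n(q))_{n\ge0}$ and $(\widetilde L^{(\alpha)*}_n(q))_{n\ge0}$ are $q$-Stieltjes moment and $3$-$q$-log-convex; (ii) the infinite triangular matrix $[B_{n,k}]_{n,k\ge0}$ is totally positive, that is, all its minors are nonnegative; (iii) if $(x_n)_{n\ge0}$ and $(y_n)_{n\ge0}$ are Stieltjes moment sequences of real numbers, then so is the sequence $z_n=\sum_{k=0}^n\binom{n+\alpha}{n-k}\frac{n!}{k!}\,x_k\,y_{n-k}$, $n\ge0$. -/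

import Mathlib

open Polynomial MeasureTheory
open scoped Nat

noncomputable section

/-- An infinite real matrix is totally positive if all its minors are nonnegative; a minor is given
by increasing choices of `m` rows and of `m` columns. -/
def IsTotallyPositive (M : ℕ → ℕ → ℝ) : Prop :=
  ∀ (m : ℕ) (r c : Fin m → ℕ), StrictMono r → StrictMono c →
    0 ≤ (Matrix.of fun i j : Fin m => M (r i) (c j)).det

/-- Membership in `ℝ≥0[q]`: all coefficients are nonnegative. -/
def HasNonnegCoeffs (p : ℝ[X]) : Prop := ∀ i : ℕ, 0 ≤ p.coeff i

/-- An infinite matrix of polynomials in `q` is `q`-totally positive if all its minors are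
polynomials with nonnegative coefficients. -/
def IsQTotallyPositive (M : ℕ → ℕ → ℝ[X]) : Prop :=
  ∀ (m : ℕ) (r c : Fin m → ℕ), StrictMono r → StrictMono c →
    HasNonnegCoeffs (Matrix.of fun i j : Fin m => M (r i) (c j)).det

/-- A sequence of polynomials in `q` is a `q`-Stieltjes moment sequence if its Hankel matrix is
`q`-totally positive. -/
def IsQStieltjesMoment (a : ℕ → ℝ[X]) : Prop :=
  IsQTotallyPositive fun i j => a (i + j)

/-- The operator `𝓛[a_i] = a_{i-1} a_{i+1} - a_i ^ 2`, defined for `i ≥ 1`. Its output, a sequence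
indexed by `i ≥ 1`, is re-indexed from `0`: the entry with index `n` is `𝓛[a_{n+1}]`. -/
def logConvexOp (a : ℕ → ℝ[X]) : ℕ → ℝ[X] :=
  fun n => a n * a (n + 2) - a (n + 1) ^ 2

/-- `k`-`q`-log-convexity: `𝓛 ^ m` of the sequence has all its entries in `ℝ≥0[q]`, for every
`m ≤ k`. -/
def IsIteratedQLogConvex (k : ℕ) (a : ℕ → ℝ[X]) : Prop :=
  ∀ m ≤ k, ∀ n : ℕ, HasNonnegCoeffs (logConvexOp^[m] a n)

/-- A real sequence is a Stieltjes moment sequence if it is the sequence of moments of a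
nonnegative measure carried by `[0, ∞)` (all of whose moments exist). -/
def IsStieltjesMoment (a : ℕ → ℝ) : Prop :=
  ∃ μ : Measure ℝ, μ (Set.Iio 0) = 0 ∧
    ∀ k : ℕ, Integrable (fun x : ℝ => x ^ k) μ ∧ a k = ∫ x, x ^ k ∂μ

/-- The `A`-convolution `z_n = ∑_{k=0}^n A_{n,k} x_k y_{n-k}`. -/
def triangularConvolution (A : ℕ → ℕ → ℝ) (x y : ℕ → ℝ) : ℕ → ℝ :=
  fun n => ∑ k ∈ Finset.range (n + 1), A n k * x k * y (n - k)

/-- The `A`-convolution preserves the Stieltjes moment property. -/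
def PreservesStieltjesMoment (A : ℕ → ℕ → ℝ) : Prop :=
  ∀ x y : ℕ → ℝ, IsStieltjesMoment x → IsStieltjesMoment y →
    IsStieltjesMoment (triangularConvolution A x y)

/-- The lower triangular matrix `[binom(n + α, n - k) n! / k!]_{n,k}`, with the generalized
binomial coefficient of a real upper argument. -/
def laguerreTriangle (α : ℝ) (n k : ℕ) : ℝ :=
  if k ≤ n then Ring.choose ((n : ℝ) + α) (n - k) * ((n ! : ℝ) / (k ! : ℝ)) else 0

/-- The Laguerre polynomial `L_n^{(α)}(q) = ∑_{k=0}^n binom(n + α, n - k) (n! / k!) (-q)^k`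
(normalized with the factor `n!`). -/
def laguerrePoly (α : ℝ) (n : ℕ) : ℝ[X] :=
  ∑ k ∈ Finset.range (n + 1), C (laguerreTriangle α n k) * (-X) ^ k

/-- The signless Laguerre polynomial `L_n^{(α)}(-q)`. -/
def signlessLaguerrePoly (α : ℝ) (n : ℕ) : ℝ[X] :=
  (laguerrePoly α n).comp (-X)

/-- The reciprocal polynomial `q^n p(1/q)` of the `n`-th signless Laguerre polynomial `p`. -/
def signlessLaguerreReciprocal (α : ℝ) (n : ℕ) : ℝ[X] :=
  (signlessLaguerrePoly α n).reflect n

/-- The generalized binomial coefficient used above is `x (x - 1) ⋯ (x - m + 1) / m!`. -/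
theorem ring_choose_real_eq (x : ℝ) (m : ℕ) :
    Ring.choose x m = (∏ i ∈ Finset.range m, (x - (i : ℝ))) / (m ! : ℝ) := by
  rw [Ring.choose_eq_smul, ← descPochhammer_eval_eq_prod_range, smul_eq_mul, div_eq_inv_mul,
    ← descPochhammer_map (Int.castRingHom ℝ) m, Polynomial.eval_map,
    ← Polynomial.aeval_eq_smeval]
  rfl

theorem signlessLaguerrePoly_eq_sum (α : ℝ) (n : ℕ) :
    signlessLaguerrePoly α n =
      ∑ k ∈ Finset.range (n + 1), C (laguerreTriangle α n k) * X ^ k := by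
  simp [signlessLaguerrePoly, laguerrePoly, Polynomial.sum_comp]

/-- The reciprocal polynomial takes the value `q^n p(1/q)` at every `q ≠ 0`. -/
theorem eval_signlessLaguerreReciprocal (α : ℝ) (n : ℕ) {q : ℝ} (hq : q ≠ 0) :
    (signlessLaguerreReciprocal α n).eval q =
      q ^ n * (signlessLaguerrePoly α n).eval (1 / q) := by
  have hd : (signlessLaguerrePoly α n).natDegree ≤ n := by
    rw [signlessLaguerrePoly_eq_sum]
    refine Polynomial.natDegree_sum_le_of_forall_le _ _ fun k hk => ?_
    exact (Polynomial.natDegree_C_mul_X_pow_le _ _).trans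
      (Nat.lt_succ_iff.mp (Finset.mem_range.mp hk))
  let _ : Invertible (q⁻¹) := invertibleOfNonzero (inv_ne_zero hq)
  have h := Polynomial.eval₂_reflect_mul_pow (RingHom.id ℝ) (q⁻¹) n _ hd
  simp only [invOf_eq_inv, inv_inv] at h
  rw [signlessLaguerreReciprocal, one_div]
  simp only [Polynomial.eval]
  rw [← h, mul_comm (q ^ n), mul_assoc, inv_pow, inv_mul_cancel₀ (pow_ne_zero n hq), mul_one]

end

/-!
The signless Laguerre polynomials satisfy `L̃^{(α+1)}_n = (1 + ∂) L̃^{(α)}_n` and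
`L̃^{(α)}_{n+1} = (α + 1 + q (1 + ∂)) L̃^{(α+1)}_n`, so they are the iterates on the constant `1` of
the operator `F = (α + 1 + q (1 + ∂)) ∘ (1 + ∂)`. In the monomial basis `1 + ∂` and multiplication
by `q` are bidiagonal, and a sum `D + U L` with `D` diagonal and `U`, `L` bidiagonal factors through
the direct sum of two copies of the space as a product of two staircase matrices. By the
Cauchy–Binet formula all minors of `F` are therefore nonnegative. This property passes to the
coefficient matrix of the iterates `F ^ n 1`, which is part (ii). It also passes to the Hankel
matrix of the constant terms of `F ^ n 1`, since `F ^ (i + j)` factors as `F ^ j ∘ F ^ i`; after the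
translation `q ↦ q + x` these constant terms are the values `L̃_n(x)`, with `x` an indeterminate.
The homogeneous version, with `1 + y ∂` in place of `1 + ∂`, covers the reciprocal polynomials.

The iterates of `𝓛` up to the third are polynomials with nonnegative coefficients in Hankel minors:
for the third this is Desnanot–Jacobi condensation of the Hankel determinant of order four. So
`3`-`q`-log-convexity holds for every `q`-Stieltjes moment sequence.

For part (iii), let `N` have the Poisson law of parameter `r`; its factorial moments are the powers
of `r`. The gamma law of shape `α + 1 + N` has moments `∏_{i<n} (α + 1 + N + i)`, which expand in
factorial powers of `N` with coefficients `B_{n,k}` by Chu–Vandermonde. Hence the mixture of these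
gamma laws has `n`-th moment `L̃_n(r)`. Rescaling by `t` the mixture for `r = s / t` yields
`∑ B_{n,k} s^k t^{n-k}`, and it remains to integrate over the product of the two given measures.
-/

section CauchyBinet

variable {R κ : Type*} {m : ℕ}

theorem exists_strictMono_comp_perm [LinearOrder κ] {f : Fin m → κ}
    (hf : Function.Injective f) : ∃ (k : Fin m → κ) (σ : Equiv.Perm (Fin m)),
      StrictMono k ∧ k ∘ σ = f :=
  ⟨f ∘ Tuple.sort f, (Tuple.sort f)⁻¹,
    (Tuple.monotone_sort f).strictMono_of_injective (hf.comp (Tuple.sort f).injective),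
    by ext i; simp⟩

theorem comp_perm_injective_of_strictMono [LinearOrder κ] {k k' : Fin m → κ}
    {σ σ' : Equiv.Perm (Fin m)} (hk : StrictMono k) (hk' : StrictMono k')
    (h : k ∘ σ = k' ∘ σ') : k = k' ∧ σ = σ' := by
  have hcomp : k ∘ (σ * σ'⁻¹ : Equiv.Perm (Fin m)) = k' := by
    ext i
    simpa using congrFun h (σ'⁻¹ i)
  have hkk' : k = k' := (Tuple.unique_monotone (f := k) (σ := 1) (τ := σ * σ'⁻¹)
    hk.monotone (hcomp ▸ hk'.monotone)).trans hcomp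
  subst hkk'
  exact ⟨rfl, Equiv.ext fun i => hk.injective (congrFun h i)⟩

theorem sum_injective_eq_sum_strictMono_sum_perm [Fintype κ] [LinearOrder κ] [AddCommMonoid R]
    (g : (Fin m → κ) → R) :
    ∑ f : Fin m → κ with Function.Injective f, g f =
      ∑ k : Fin m → κ with StrictMono k, ∑ σ : Equiv.Perm (Fin m), g (k ∘ σ) := by
  rw [← Finset.sum_product']
  symm
  refine Finset.sum_bij (fun p _ => p.1 ∘ p.2) ?_ ?_ ?_ fun _ _ => rfl
  · simp only [Finset.mem_product, Finset.mem_filter, Finset.mem_univ, true_and, and_true]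
    exact fun p hp => hp.injective.comp p.2.injective
  · simp only [Finset.mem_product, Finset.mem_filter, Finset.mem_univ, true_and, and_true]
    exact fun p hp q hq h => Prod.ext_iff.mpr (comp_perm_injective_of_strictMono hp hq h)
  · simp only [Finset.mem_product, Finset.mem_filter, Finset.mem_univ, true_and, and_true]
    intro f hf
    obtain ⟨k, σ, hk, rfl⟩ := exists_strictMono_comp_perm hf
    exact ⟨(k, σ), hk, rfl⟩

variable [CommRing R]

theorem det_mul_eq_sum_prod_mul_det_submatrix [Fintype κ] (A : Matrix (Fin m) κ R)
    (B : Matrix κ (Fin m) R) :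
    (A * B).det = ∑ f : Fin m → κ, (∏ i, A i (f i)) * (B.submatrix f id).det := by
  classical
  have hrow : A * B = fun i => ∑ k, A i k • B k := by
    ext i j
    simp [Matrix.mul_apply]
  change Matrix.detRowAlternating.toMultilinearMap (A * B) = _
  rw [hrow, MultilinearMap.map_sum]
  exact Finset.sum_congr rfl fun f _ => MultilinearMap.map_smul_univ _ _ _

theorem sum_perm_prod_mul_det_submatrix (A : Matrix (Fin m) κ R) (B : Matrix κ (Fin m) R)
    (k : Fin m → κ) :
    ∑ σ : Equiv.Perm (Fin m), (∏ i, A i (k (σ i))) * (B.submatrix (k ∘ σ) id).det =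
      (A.submatrix id k).det * (B.submatrix k id).det := by
  rw [← Matrix.det_transpose (A.submatrix id k), Matrix.det_apply', Finset.sum_mul]
  refine Finset.sum_congr rfl fun σ _ => ?_
  have hperm := Matrix.det_permute σ (B.submatrix k id)
  rw [Matrix.submatrix_submatrix, Function.id_comp] at hperm
  rw [hperm]
  simp only [Matrix.transpose_apply, Matrix.submatrix_apply, id_eq]
  ring

theorem det_mul_eq_sum_strictMono [Fintype κ] [LinearOrder κ] (A : Matrix (Fin m) κ R)
    (B : Matrix κ (Fin m) R) :
    (A * B).det = ∑ k : Fin m → κ with StrictMono k,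
      (A.submatrix id k).det * (B.submatrix k id).det := by
  have hdet_zero (f : Fin m → κ) (hf : ¬ Function.Injective f) :
      (B.submatrix f id).det = 0 := by
    obtain ⟨i, j, hij, hne⟩ := Function.not_injective_iff.mp hf
    exact Matrix.det_zero_of_row_eq hne (funext fun l => by simp [hij])
  rw [det_mul_eq_sum_prod_mul_det_submatrix,
    ← Finset.sum_filter_of_ne fun f _ hf => not_imp_comm.mp (hdet_zero f) (right_ne_zero_of_mul hf),
    sum_injective_eq_sum_strictMono_sum_perm]
  exact Finset.sum_congr rfl fun k _ => sum_perm_prod_mul_det_submatrix A B k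

end CauchyBinet

section TotalPositivity

variable {R ι κ μ V : Type*} [CommRing R] [AddCommGroup V] [Module R V]
  [Preorder ι] [Preorder μ] {S : Subsemiring R}

/-- Total positivity with values in a subsemiring: every minor of `M`, given by increasing choices
of rows and of columns, lies in `S`. For `S` the nonnegative reals this is total positivity, and
for `S` the polynomials with nonnegative coefficients it is `q`-total positivity. -/
def MinorsMem [Preorder κ] (S : Subsemiring R) (M : Matrix ι κ R) : Prop :=
  ∀ (m : ℕ) (r : Fin m → ι) (c : Fin m → κ), StrictMono r → StrictMono c →
    (M.submatrix r c).det ∈ S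

/-- The basis of `V × V` obtained by alternating the vectors of a basis `b` of `V`, in the order
`(b 0, 0), (0, b 0), (b 1, 0), (0, b 1), …`. It turns a sum `D + U ∘ L` into a composition
`V → V × V → V` in which minors can be followed. -/
noncomputable def interleavedBasis (b : Module.Basis ℕ R V) : Module.Basis (ℕ ×ₗ Bool) R (V × V) :=
  (b.prod b).reindex
    (((Equiv.boolProdEquivSum ℕ).symm.trans (Equiv.prodComm _ _)).trans toLex)

theorem interleavedBasis_false (b : Module.Basis ℕ R V) (k : ℕ) :
    interleavedBasis b (toLex (k, false)) = (b k, 0) := by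
  simp [interleavedBasis]

theorem interleavedBasis_true (b : Module.Basis ℕ R V) (k : ℕ) :
    interleavedBasis b (toLex (k, true)) = (0, b k) := by
  simp [interleavedBasis]

theorem interleavedBasis_repr_false (b : Module.Basis ℕ R V) (v : V × V) (k : ℕ) :
    (interleavedBasis b).repr v (toLex (k, false)) = b.repr v.1 k :=
  (Module.Basis.repr_reindex_apply ..).trans (Module.Basis.prod_repr_inl ..)

theorem interleavedBasis_repr_true (b : Module.Basis ℕ R V) (v : V × V) (k : ℕ) :
    (interleavedBasis b).repr v (toLex (k, true)) = b.repr v.2 k :=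
  (Module.Basis.repr_reindex_apply ..).trans (Module.Basis.prod_repr_inr ..)

theorem exists_strictMono_succ_comp {m n : ℕ} {r : Fin m → Fin (n + 1)} (hr : StrictMono r)
    (hr0 : ∀ i, r i ≠ 0) : ∃ r' : Fin m → Fin n, StrictMono r' ∧ Fin.succ ∘ r' = r :=
  ⟨fun i => (r i).pred (hr0 i), fun _ _ h => Fin.pred_lt_pred_iff.mpr (hr h),
    funext fun i => Fin.succ_pred _ (hr0 i)⟩

namespace MinorsMem

theorem transpose [Preorder κ] {M : Matrix ι κ R} (hM : MinorsMem S M) : MinorsMem S M.transpose :=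
  fun m r c hr hc => by
    rw [← Matrix.transpose_submatrix, Matrix.det_transpose]
    exact hM m c r hc hr

theorem of_staircase [LinearOrder κ] {M : Matrix ι κ R} (hmem : ∀ i j, M i j ∈ S)
    (hstair : ∀ ⦃i i' j j'⦄, i < i' → M i j ≠ 0 → M i' j' ≠ 0 → j ≤ j') : MinorsMem S M := by
  intro m r c hr hc
  have exists_zero (σ : Equiv.Perm (Fin m)) (hσ : σ ≠ 1) : ∃ i, M (r (σ i)) (c i) = 0 := by
    by_contra! hne
    have hne' (i : Fin m) : M (r i) (c (σ⁻¹ i)) ≠ 0 := by simpa using hne (σ⁻¹ i)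
    have hmono : Monotone (σ⁻¹ : Equiv.Perm (Fin m)) := monotone_iff_forall_lt.mpr fun i i' hi =>
      hc.le_iff_le.mp (hstair (hr hi) (hne' i) (hne' i'))
    exact hσ (inv_eq_one.mp ((Equiv.Perm.monotone_iff _).mp hmono))
  rw [Matrix.det_apply', Finset.sum_eq_single_of_mem 1 (Finset.mem_univ _)]
  · simpa using S.prod_mem fun i _ => hmem (r i) (c i)
  · intro σ _ hσ
    obtain ⟨i, hi⟩ := exists_zero σ hσ
    rw [Finset.prod_eq_zero (Finset.mem_univ i) (by exact hi), mul_zero]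

theorem map_basis [LinearOrder κ] (b : Module.Basis κ R V) (f : V →ₗ[R] μ → R) {v : ι → V}
    (hv : MinorsMem S (fun i k => b.repr (v i) k)) (hf : MinorsMem S (fun k => f (b k))) :
    MinorsMem S (fun i => f (v i)) := by
  intro m r c hr hc
  set s : Finset κ := Finset.univ.biUnion fun i => (b.repr (v (r i))).support
  have hfactor : (Matrix.submatrix (fun i => f (v i)) r c : Matrix (Fin m) (Fin m) R) =
      Matrix.of (fun i (k : s) => b.repr (v (r i)) k) *
        Matrix.of fun (k : s) j => f (b k) (c j) := by
    ext i j
    have hsupp : (b.repr (v (r i))).support ⊆ s :=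
      Finset.subset_biUnion_of_mem (fun i => (b.repr (v (r i))).support) (Finset.mem_univ i)
    have hexpand : f (v (r i)) = ∑ k ∈ s, b.repr (v (r i)) k • f (b k) := by
      conv_lhs => rw [← b.linearCombination_repr (v (r i)), Finsupp.apply_linearCombination]
      exact Finsupp.sum_of_support_subset _ hsupp _ (by simp)
    change f (v (r i)) (c j) = _
    rw [hexpand, Finset.sum_apply, Matrix.mul_apply]
    exact (Finset.sum_coe_sort s fun k => b.repr (v (r i)) k * f (b k) (c j)).symm
  rw [hfactor, det_mul_eq_sum_strictMono]
  refine S.sum_mem fun k hk => S.mul_mem ?_ ?_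
  · exact hv m r (fun i => k i) hr (Finset.mem_filter.mp hk).2
  · exact hf m (fun i => k i) c (Finset.mem_filter.mp hk).2 hc

theorem comp_basis [LinearOrder κ] {W : Type*} [AddCommGroup W] [Module R W]
    {a : ι → V} (b : Module.Basis κ R V) (c : Module.Basis μ R W) {F : V →ₗ[R] W}
    (ha : MinorsMem S (fun i k => b.repr (a i) k))
    (hF : MinorsMem S (fun k l => c.repr (F (b k)) l)) :
    MinorsMem S (fun i l => c.repr (F (a i)) l) :=
  map_basis b (Finsupp.lcoeFun ∘ₗ c.repr.toLinearMap ∘ₗ F) ha hF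

theorem of_row_zero_eq_single_bot [LinearOrder κ] [OrderBot κ] {n : ℕ}
    {M : Matrix (Fin (n + 1)) κ R} (hzero : M 0 = Pi.single ⊥ 1)
    (hM : MinorsMem S (fun i : Fin n => M i.succ)) : MinorsMem S M := by
  intro m r c hr hc
  by_cases hr0 : ∀ i, r i ≠ 0
  · obtain ⟨r', hr', rfl⟩ := exists_strictMono_succ_comp hr hr0
    exact hM m r' c hr' hc
  obtain ⟨i, hi⟩ := not_forall_not.mp hr0
  obtain _ | m := m
  · exact i.elim0
  have hr_zero : r 0 = 0 := Fin.le_zero_iff.mp (hi ▸ hr.monotone (Fin.zero_le i))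
  obtain ⟨r', hr', hsucc⟩ := exists_strictMono_succ_comp (hr.comp (Fin.strictMono_succ))
    fun j => Fin.ne_zero_of_lt (hr j.succ_pos)
  have hrow (j : Fin (m + 1)) : M.submatrix r c 0 j = (Pi.single ⊥ 1 : κ → R) (c j) := by
    rw [Matrix.submatrix_apply, hr_zero, hzero]
  have hentry : (Pi.single ⊥ 1 : κ → R) (c 0) ∈ S := by
    rw [Pi.single_apply]
    split_ifs
    exacts [S.one_mem, S.zero_mem]
  have hminor : (M.submatrix (r ∘ Fin.succ) (c ∘ Fin.succ)).det ∈ S :=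
    hsucc ▸ hM m r' (c ∘ Fin.succ) hr' (hc.comp Fin.strictMono_succ)
  rw [Matrix.det_succ_row_zero, Finset.sum_eq_single_of_mem 0 (Finset.mem_univ _)]
  · simpa [hzero, hr_zero] using S.mul_mem hentry hminor
  · intro j _ hj
    have hcj : c j ≠ ⊥ := (hc (Fin.pos_of_ne_zero hj)).ne_bot
    rw [hrow, Pi.single_eq_of_ne hcj, mul_zero, zero_mul]

theorem of_forall_fin [Preorder κ] {M : Matrix ℕ κ R}
    (hM : ∀ n, MinorsMem S (fun i : Fin n => M i)) : MinorsMem S M := by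
  intro m r c hr hc
  obtain ⟨n, hn⟩ := (Set.finite_range r).bddAbove
  exact hM (n + 1) m (fun i => ⟨r i, Nat.lt_succ_of_le (hn ⟨i, rfl⟩)⟩) c hr hc

theorem of_succ_rows [LinearOrder κ] [OrderBot κ] {M : Matrix ℕ κ R}
    (hzero : M 0 = Pi.single ⊥ 1)
    (hsucc : ∀ n, MinorsMem S (fun i : Fin n => M i) →
      MinorsMem S (fun i : Fin n => M (i + 1))) : MinorsMem S M := by
  refine of_forall_fin fun n => ?_
  induction n with
  | zero =>
    intro m r c _ _
    obtain _ | m := m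
    · simp
    · exact (r 0).elim0
  | succ n ih => exact of_row_zero_eq_single_bot hzero (hsucc n ih)

theorem pow_apply_basis [LinearOrder κ] [OrderBot κ] (b : Module.Basis κ R V) {F : V →ₗ[R] V}
    (hF : MinorsMem S (fun k l => b.repr (F (b k)) l)) :
    MinorsMem S (fun (n : ℕ) k => b.repr ((F ^ n) (b ⊥)) k) := by
  refine of_succ_rows ?_ fun n hn => ?_
  · ext k
    simp [Finsupp.single_eq_pi_single]
  · simpa only [pow_succ', Module.End.mul_apply] using hn.comp_basis b b hF

theorem coord_bot_pow [LinearOrder κ] [OrderBot κ] (b : Module.Basis κ R V) {F : V →ₗ[R] V}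
    (hF : MinorsMem S (fun k l => b.repr (F (b k)) l)) :
    MinorsMem S (fun (n : ℕ) k => b.coord ⊥ ((F ^ n) (b k))) := by
  refine of_succ_rows ?_ fun n hn => ?_
  · ext k
    simp [Finsupp.single_apply, Pi.single_apply]
  · exact (map_basis b (LinearMap.pi fun i : Fin n => b.coord ⊥ ∘ₗ F ^ (i : ℕ)) hF
      hn.transpose).transpose

theorem hankel_coord_bot_pow [LinearOrder κ] [OrderBot κ] (b : Module.Basis κ R V)
    {F : V →ₗ[R] V} (hF : MinorsMem S (fun k l => b.repr (F (b k)) l)) :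
    MinorsMem S (fun i j : ℕ => b.coord ⊥ ((F ^ (i + j)) (b ⊥))) := by
  have hadd (i j : ℕ) : (F ^ (i + j)) (b ⊥) = (F ^ j) ((F ^ i) (b ⊥)) := by
    rw [add_comm, pow_add, Module.End.mul_apply]
  simp only [hadd]
  exact map_basis b (LinearMap.pi fun j : ℕ => b.coord ⊥ ∘ₗ F ^ j) (pow_apply_basis b hF)
    (coord_bot_pow b hF).transpose

theorem interleavedBasis_repr_prod_bidiagonal (b : Module.Basis ℕ R V) {D L : V →ₗ[R] V}
    (hDmem : ∀ i k, b.repr (D (b i)) k ∈ S) (hD : ∀ i k, b.repr (D (b i)) k ≠ 0 → k = i)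
    (hLmem : ∀ i k, b.repr (L (b i)) k ∈ S)
    (hL : ∀ i k, b.repr (L (b i)) k ≠ 0 → k ≤ i ∧ i ≤ k + 1) :
    MinorsMem S (fun i l => (interleavedBasis b).repr (D.prod L (b i)) l) := by
  have hsupport (i k : ℕ) (x : Bool) (h : (interleavedBasis b).repr (D.prod L (b i))
      (toLex (k, x)) ≠ 0) : k ≤ i ∧ i ≤ k + x.toNat := by
    cases x
    · rw [interleavedBasis_repr_false] at h
      simpa [le_antisymm_iff] using hD i k h
    · rw [interleavedBasis_repr_true] at h
      exact hL i k h
  refine of_staircase (fun i => Lex.rec fun (k, x) => ?_) fun i i' => Lex.rec fun (k, x) =>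
    Lex.rec fun (k', x') hi hk hk' => ?_
  · cases x
    · exact interleavedBasis_repr_false b _ k ▸ hDmem i k
    · exact interleavedBasis_repr_true b _ k ▸ hLmem i k
  · have hk := hsupport i k x hk
    have hk' := hsupport i' k' x' hk'
    have hx' := x'.toNat_le
    rw [Prod.Lex.toLex_le_toLex]
    obtain hlt | rfl := (show k ≤ k' by omega).lt_or_eq
    · exact .inl hlt
    · have htrue : x' = true := Bool.toNat_eq_one.mp (by omega)
      exact .inr ⟨rfl, htrue ▸ Bool.le_true x⟩

theorem coprod_bidiagonal_interleavedBasis (b : Module.Basis ℕ R V) {U : V →ₗ[R] V}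
    (hUmem : ∀ i k, b.repr (U (b i)) k ∈ S)
    (hU : ∀ i k, b.repr (U (b i)) k ≠ 0 → i ≤ k ∧ k ≤ i + 1) :
    MinorsMem S (fun l k => b.repr (LinearMap.coprod .id U (interleavedBasis b l)) k) := by
  have hrow_false (k : ℕ) :
      LinearMap.coprod .id U (interleavedBasis b (toLex (k, false))) = b k := by
    simp [interleavedBasis_false]
  have hrow_true (k : ℕ) :
      LinearMap.coprod .id U (interleavedBasis b (toLex (k, true))) = U (b k) := by
    simp [interleavedBasis_true]
  have hsupport (k j : ℕ) (x : Bool) (h : b.repr (LinearMap.coprod .id U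
      (interleavedBasis b (toLex (k, x)))) j ≠ 0) : k ≤ j ∧ j ≤ k + x.toNat := by
    cases x
    · simp_all [Finsupp.single_apply]
    · exact hU k j (hrow_true k ▸ h)
  refine of_staircase (Lex.rec fun (k, x) j => ?_) (Lex.rec fun (k, x) => Lex.rec fun (k', x') =>
    fun j j' hi hk hk' => ?_)
  · cases x
    · simp only [hrow_false, b.repr_self, Finsupp.single_apply]
      split_ifs
      exacts [S.one_mem, S.zero_mem]
    · exact hrow_true k ▸ hUmem k j
  · have hk := hsupport k j x hk
    have hk' := hsupport k' j' x' hk'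
    have hx := x.toNat_le
    obtain hlt | ⟨rfl, hlt⟩ := Prod.Lex.toLex_lt_toLex.mp hi
    · exact (show j ≤ j' by simp only at hlt; omega)
    · have hfalse : x = false := (Bool.lt_iff.mp hlt).1
      exact (show j ≤ j' by simp only [hfalse, Bool.toNat_false] at hk; omega)

theorem add_comp_bidiagonal (b : Module.Basis ℕ R V) {D L U : V →ₗ[R] V}
    (hDmem : ∀ i k, b.repr (D (b i)) k ∈ S) (hD : ∀ i k, b.repr (D (b i)) k ≠ 0 → k = i)
    (hLmem : ∀ i k, b.repr (L (b i)) k ∈ S)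
    (hL : ∀ i k, b.repr (L (b i)) k ≠ 0 → k ≤ i ∧ i ≤ k + 1)
    (hUmem : ∀ i k, b.repr (U (b i)) k ∈ S)
    (hU : ∀ i k, b.repr (U (b i)) k ≠ 0 → i ≤ k ∧ k ≤ i + 1) :
    MinorsMem S (fun i k => b.repr ((D + U ∘ₗ L) (b i)) k) := by
  have hcomp : D + U ∘ₗ L = LinearMap.coprod .id U ∘ₗ D.prod L := by ext; simp
  simp only [hcomp, LinearMap.comp_apply]
  exact (interleavedBasis_repr_prod_bidiagonal b hDmem hD hLmem hL).comp_basis _ b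
    (coprod_bidiagonal_interleavedBasis b hUmem hU)

end MinorsMem

end TotalPositivity

section HomLaguerre

variable {R : Type*} [CommRing R]

/-- The coefficients of the signless Laguerre polynomials with the parameter `d = α + 1`, made
homogeneous of degree `n - k` in `y` and `d`, so that `y = 1` gives the usual
polynomials and `y = X`, at the argument `1`, their reciprocals. -/
def homLaguerreCoeff (y d : R) (n k : ℕ) : R :=
  n.choose k * ∏ i ∈ Finset.Ico k n, (d + i * y)

theorem homLaguerreCoeff_eq_zero (y d : R) {n k : ℕ} (h : n < k) :
    homLaguerreCoeff y d n k = 0 := by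
  simp [homLaguerreCoeff, Nat.choose_eq_zero_of_lt h]

theorem map_homLaguerreCoeff {R' : Type*} [CommRing R'] (f : R →+* R') (y d : R) (n k : ℕ) :
    f (homLaguerreCoeff y d n k) = homLaguerreCoeff (f y) (f d) n k := by
  simp [homLaguerreCoeff]

theorem homLaguerreCoeff_mul_mul (c y d : R) (n k : ℕ) :
    homLaguerreCoeff (c * y) (c * d) n k = c ^ (n - k) * homLaguerreCoeff y d n k := by
  have hfactor (i : ℕ) : c * d + i * (c * y) = c * (d + i * y) := by ring
  simp only [homLaguerreCoeff, hfactor, Finset.prod_mul_distrib, Finset.prod_const, Nat.card_Ico]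
  ring

theorem prod_Ico_succ_add_mul (y d : R) (n k : ℕ) :
    ∏ i ∈ Finset.Ico (k + 1) (n + 1), (d + i * y) = ∏ i ∈ Finset.Ico k n, (d + y + i * y) := by
  rw [← Finset.prod_Ico_add' (fun i : ℕ => d + i * y)]
  exact Finset.prod_congr rfl fun i _ => by push_cast; ring

theorem homLaguerreCoeff_add_parameter (y d : R) (n k : ℕ) :
    homLaguerreCoeff y (d + y) n k =
      homLaguerreCoeff y d n k + y * (homLaguerreCoeff y d n (k + 1) * (k + 1)) := by
  obtain hkn | hnk := lt_or_ge k n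
  · have hchoose : (n.choose (k + 1) : R) * (k + 1) = n.choose k * (n - k) := by
      have h := congrArg (Nat.cast (R := R)) (n.choose_succ_right_eq k)
      push_cast [hkn.le] at h
      exact h
    simp only [homLaguerreCoeff]
    rw [← prod_Ico_succ_add_mul, Finset.prod_Ico_succ_top hkn,
      Finset.prod_eq_prod_Ico_succ_bot hkn]
    linear_combination (-y * ∏ i ∈ Finset.Ico (k + 1) n, (d + i * y)) * hchoose
  · rw [homLaguerreCoeff_eq_zero y d (Nat.lt_succ_of_le hnk)]
    simp [homLaguerreCoeff, Finset.Ico_eq_empty_of_le hnk]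

theorem homLaguerreCoeff_succ_zero (y d : R) (n : ℕ) :
    homLaguerreCoeff y d (n + 1) 0 = d * homLaguerreCoeff y (d + y) n 0 := by
  simp only [homLaguerreCoeff, Nat.choose_zero_right]
  rw [Finset.prod_eq_prod_Ico_succ_bot n.succ_pos, prod_Ico_succ_add_mul]
  simp

theorem homLaguerreCoeff_succ_succ (y d : R) (n k : ℕ) :
    homLaguerreCoeff y d (n + 1) (k + 1) =
      d * homLaguerreCoeff y (d + y) n (k + 1) +
      (homLaguerreCoeff y (d + y) n k +
        y * (homLaguerreCoeff y (d + y) n (k + 1) * (k + 1))) := by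
  simp only [homLaguerreCoeff]
  rw [prod_Ico_succ_add_mul, Nat.choose_succ_succ, Nat.cast_add]
  obtain hkn | hnk := lt_or_ge k n
  · rw [Finset.prod_eq_prod_Ico_succ_bot hkn]
    ring
  · simp [Nat.choose_eq_zero_of_lt (Nat.lt_succ_of_le hnk)]

/-- The signless Laguerre polynomials with the homogeneous coefficients `homLaguerreCoeff`. -/
noncomputable def homLaguerre (y d : R) (n : ℕ) : R[X] :=
  ∑ k ∈ Finset.range (n + 1), C (homLaguerreCoeff y d n k) * X ^ k

theorem coeff_homLaguerre (y d : R) (n k : ℕ) :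
    (homLaguerre y d n).coeff k = homLaguerreCoeff y d n k := by
  have hvanish : n + 1 ≤ k → homLaguerreCoeff y d n k = 0 := homLaguerreCoeff_eq_zero y d
  simpa [homLaguerre, coeff_C_mul_X_pow] using fun h => (hvanish h).symm

theorem eval_homLaguerre (x y d : R) (n : ℕ) :
    (homLaguerre y d n).eval x = ∑ k ∈ Finset.range (n + 1), homLaguerreCoeff y d n k * x ^ k := by
  simp [homLaguerre, eval_finsetSum]

theorem homLaguerre_zero (y d : R) : homLaguerre y d 0 = 1 := by
  simp [homLaguerre, homLaguerreCoeff]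

/-- The operator `1 + y ∂`, which raises the parameter `d` of `homLaguerre y d` by `y`. -/
noncomputable def raiseParameter (y : R) : R[X] →ₗ[R] R[X] :=
  .id + y • derivative

/-- The operator `d + (X + x)(1 + y ∂)`. For `x = 0` it lowers the parameter from `d + y` to `d`
and raises the degree; in general it is the conjugate of that operator by the translation
`X ↦ X + x`. -/
noncomputable def raiseDegree (x y d : R) : R[X] →ₗ[R] R[X] :=
  d • .id + LinearMap.mulLeft R (X + C x) ∘ₗ raiseParameter y

theorem raiseParameter_homLaguerre (y d : R) (n : ℕ) :
    raiseParameter y (homLaguerre y d n) = homLaguerre y (d + y) n := by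
  ext k
  simp [raiseParameter, coeff_derivative, coeff_homLaguerre, homLaguerreCoeff_add_parameter]

theorem raiseDegree_homLaguerre (y d : R) (n : ℕ) :
    raiseDegree 0 y d (homLaguerre y (d + y) n) = homLaguerre y d (n + 1) := by
  ext k
  cases k with
  | zero => simp [raiseDegree, coeff_homLaguerre, homLaguerreCoeff_succ_zero]
  | succ k =>
    simp [raiseDegree, raiseParameter, coeff_homLaguerre, coeff_derivative, coeff_X_mul,
      homLaguerreCoeff_succ_succ]

theorem taylor_raiseParameter (x y : R) (p : R[X]) :
    taylor x (raiseParameter y p) = raiseParameter y (taylor x p) := by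
  simp [raiseParameter, derivative_comp, taylor_apply]

theorem taylor_raiseDegree (x y d : R) (p : R[X]) :
    taylor x (raiseDegree 0 y d p) = raiseDegree x y d (taylor x p) := by
  simp [raiseDegree, taylor_mul, taylor_raiseParameter, taylor_X]

theorem production_pow_one (x y d : R) (n : ℕ) :
    ((raiseDegree x y d ∘ₗ raiseParameter y) ^ n) 1 = taylor x (homLaguerre y d n) := by
  induction n with
  | zero => simp [homLaguerre_zero]
  | succ n ih =>
    rw [pow_succ', Module.End.mul_apply, ih, LinearMap.comp_apply, ← taylor_raiseParameter,
      ← taylor_raiseDegree, raiseParameter_homLaguerre, raiseDegree_homLaguerre]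

variable {S : Subsemiring R} {x y d : R}

theorem coeff_raiseParameter_X_pow (y : R) (i k : ℕ) :
    (raiseParameter y (X ^ i)).coeff k =
      (if k = i then 1 else 0) + if k + 1 = i then y * (k + 1) else 0 := by
  simp [raiseParameter, coeff_X_pow, coeff_derivative]

theorem coeff_X_add_C_mul_X_pow (x : R) (i k : ℕ) :
    ((X + C x) * X ^ i).coeff k =
      (if k = i + 1 then 1 else 0) + if k = i then x else 0 := by
  rw [add_mul, ← pow_succ', coeff_add, coeff_X_pow, coeff_C_mul_X_pow]

theorem repr_basisMonomials (p : R[X]) (k : ℕ) : (basisMonomials R).repr p k = p.coeff k := rfl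

theorem ite_zero_mem {p : Prop} [Decidable p] {a : R} (ha : a ∈ S) : (if p then a else 0) ∈ S := by
  split
  exacts [ha, S.zero_mem]

theorem coeff_raiseParameter_X_pow_mem (hy : y ∈ S) (i k : ℕ) :
    (raiseParameter y (X ^ i)).coeff k ∈ S := by
  rw [coeff_raiseParameter_X_pow]
  exact S.add_mem (ite_zero_mem S.one_mem)
    (ite_zero_mem (S.mul_mem hy (S.add_mem (natCast_mem S k) S.one_mem)))

theorem bidiagonal_raiseParameter {i k : ℕ} (h : (raiseParameter y (X ^ i)).coeff k ≠ 0) :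
    k ≤ i ∧ i ≤ k + 1 := by
  contrapose! h
  rw [coeff_raiseParameter_X_pow, if_neg (by omega), if_neg (by omega), add_zero]

theorem minorsMem_raiseParameter (hy : y ∈ S) :
    MinorsMem S fun i k => (basisMonomials R).repr (raiseParameter y (basisMonomials R i)) k := by
  simp only [repr_basisMonomials, coe_basisMonomials, ← X_pow_eq_monomial]
  refine MinorsMem.of_staircase (coeff_raiseParameter_X_pow_mem hy) fun i i' k k' hi h h' => ?_
  have := bidiagonal_raiseParameter h
  have := bidiagonal_raiseParameter h'
  omega

theorem minorsMem_raiseDegree (hx : x ∈ S) (hy : y ∈ S) (hd : d ∈ S) :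
    MinorsMem S fun i k => (basisMonomials R).repr (raiseDegree x y d (basisMonomials R i)) k := by
  refine MinorsMem.add_comp_bidiagonal (basisMonomials R) ?_ ?_ ?_ ?_ ?_ ?_ <;>
    simp only [repr_basisMonomials, coe_basisMonomials, ← X_pow_eq_monomial,
      LinearMap.smul_apply, LinearMap.id_apply, LinearMap.mulLeft_apply, coeff_smul, coeff_X_pow,
      coeff_X_add_C_mul_X_pow, smul_eq_mul, mul_ite, mul_one, mul_zero]
  · exact fun i k => ite_zero_mem hd
  · exact fun i k h => by_contra fun hk => h (if_neg hk)
  · exact coeff_raiseParameter_X_pow_mem hy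
  · exact fun i k => bidiagonal_raiseParameter
  · exact fun i k => S.add_mem (ite_zero_mem S.one_mem) (ite_zero_mem hx)
  · intro i k h
    contrapose! h
    rw [if_neg (by omega), if_neg (by omega), add_zero]

theorem minorsMem_production (hx : x ∈ S) (hy : y ∈ S) (hd : d ∈ S) :
    MinorsMem S fun i k => (basisMonomials R).repr
      ((raiseDegree x y d ∘ₗ raiseParameter y) (basisMonomials R i)) k := by
  simpa only [LinearMap.comp_apply] using MinorsMem.comp_basis _ _ (minorsMem_raiseParameter hy)
    (minorsMem_raiseDegree hx hy hd)

theorem minorsMem_homLaguerreCoeff (hy : y ∈ S) (hd : d ∈ S) :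
    MinorsMem S (homLaguerreCoeff y d) := by
  have h := MinorsMem.pow_apply_basis _ (minorsMem_production S.zero_mem hy hd)
  simpa only [repr_basisMonomials, coe_basisMonomials, bot_eq_zero, monomial_zero_one,
    production_pow_one, taylor_zero, coeff_homLaguerre] using h

theorem minorsMem_hankel_eval_homLaguerre (hx : x ∈ S) (hy : y ∈ S) (hd : d ∈ S) :
    MinorsMem S fun i j => (homLaguerre y d (i + j)).eval x := by
  have h := MinorsMem.hankel_coord_bot_pow _ (minorsMem_production hx hy hd)
  simpa only [Module.Basis.coord_apply, repr_basisMonomials, coe_basisMonomials, bot_eq_zero,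
    monomial_zero_one, production_pow_one, taylor_coeff_zero] using h

end HomLaguerre

section Laguerre

theorem laguerreTriangle_eq_homLaguerreCoeff (α : ℝ) :
    laguerreTriangle α = homLaguerreCoeff 1 (α + 1) := by
  ext n k
  obtain hkn | hnk := le_or_gt k n
  · have hprod : ∏ i ∈ Finset.range (n - k), ((n : ℝ) + α - i) =
        ∏ i ∈ Finset.Ico k n, (α + 1 + i * 1) := by
      rw [Finset.prod_Ico_eq_prod_range, ← Finset.prod_range_reflect]
      refine Finset.prod_congr rfl fun i hi => ?_
      have hreflect : k + i + (n - k - 1 - i + 1) = n := by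
        have := Finset.mem_range.mp hi
        omega
      have hcast := congrArg (Nat.cast (R := ℝ)) hreflect
      push_cast at hcast ⊢
      linarith
    rw [laguerreTriangle, if_pos hkn, ring_choose_real_eq, hprod, homLaguerreCoeff,
      Nat.cast_choose ℝ hkn]
    field_simp
  · rw [laguerreTriangle, if_neg hnk.not_ge, homLaguerreCoeff_eq_zero _ _ hnk]

theorem laguerreTriangle_nonneg {α : ℝ} (hα : -1 ≤ α) (n k : ℕ) : 0 ≤ laguerreTriangle α n k := by
  rw [laguerreTriangle_eq_homLaguerreCoeff, homLaguerreCoeff]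
  have : 0 ≤ α + 1 := by linarith
  positivity

theorem laguerreTriangle_self (α : ℝ) (n : ℕ) : laguerreTriangle α n n = 1 := by
  simp [laguerreTriangle_eq_homLaguerreCoeff, homLaguerreCoeff]

theorem signlessLaguerrePoly_eq_eval_homLaguerre (α : ℝ) :
    signlessLaguerrePoly α = fun n => (homLaguerre 1 (C (α + 1)) n).eval X := by
  ext1 n
  simp only [signlessLaguerrePoly_eq_sum, laguerreTriangle_eq_homLaguerreCoeff,
    map_homLaguerreCoeff, map_one, eval_homLaguerre]

theorem reflect_sum {R ι : Type*} [Semiring R] (n : ℕ) (s : Finset ι) (p : ι → R[X]) :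
    reflect n (∑ i ∈ s, p i) = ∑ i ∈ s, reflect n (p i) :=
  map_sum (⟨⟨reflect n, reflect_zero⟩, fun p q => reflect_add p q n⟩ : R[X] →+ R[X]) p s

theorem signlessLaguerreReciprocal_eq_eval_homLaguerre (α : ℝ) :
    signlessLaguerreReciprocal α = fun n => (homLaguerre X (X * C (α + 1)) n).eval 1 := by
  ext1 n
  have hcoeff (k : ℕ) : C (laguerreTriangle α n k) * X ^ (n - k) =
      homLaguerreCoeff X (X * C (α + 1)) n k := by
    rw [laguerreTriangle_eq_homLaguerreCoeff, map_homLaguerreCoeff, map_one, mul_comm,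
      ← homLaguerreCoeff_mul_mul, mul_one]
  rw [signlessLaguerreReciprocal, signlessLaguerrePoly_eq_sum, eval_homLaguerre, reflect_sum]
  refine Finset.sum_congr rfl fun k hk => ?_
  rw [reflect_C_mul_X_pow, revAt_le (Finset.mem_range_succ_iff.mp hk), hcoeff, one_pow, mul_one]

/-- The polynomials with nonnegative coefficients as a subsemiring, so that `q`-total positivity
becomes an instance of `MinorsMem`. -/
def nonnegCoeffs : Subsemiring ℝ[X] where
  carrier := {p | HasNonnegCoeffs p}
  one_mem' i := by
    rw [coeff_one]
    positivity
  zero_mem' _ := le_rfl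
  add_mem' hp hq i := by
    rw [coeff_add]
    exact add_nonneg (hp i) (hq i)
  mul_mem' hp hq i := by
    rw [coeff_mul]
    exact Finset.sum_nonneg fun j _ => mul_nonneg (hp j.1) (hq j.2)

theorem X_mem_nonnegCoeffs : X ∈ nonnegCoeffs := fun i => by
  rw [coeff_X]
  positivity

theorem C_mem_nonnegCoeffs {c : ℝ} (hc : 0 ≤ c) : C c ∈ nonnegCoeffs := fun i => by
  rw [coeff_C]
  positivity

variable {α : ℝ}

theorem isTotallyPositive_laguerreTriangle (hα : -1 ≤ α) :
    IsTotallyPositive (laguerreTriangle α) := by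
  have hmem : α + 1 ∈ Subsemiring.nonneg ℝ := by
    rw [Subsemiring.mem_nonneg]
    linarith
  rw [laguerreTriangle_eq_homLaguerreCoeff]
  exact minorsMem_homLaguerreCoeff (Subsemiring.one_mem _) hmem

theorem isQStieltjesMoment_signlessLaguerrePoly (hα : -1 ≤ α) :
    IsQStieltjesMoment (signlessLaguerrePoly α) := by
  rw [signlessLaguerrePoly_eq_eval_homLaguerre]
  exact minorsMem_hankel_eval_homLaguerre X_mem_nonnegCoeffs nonnegCoeffs.one_mem
    (C_mem_nonnegCoeffs (by linarith))

theorem isQStieltjesMoment_signlessLaguerreReciprocal (hα : -1 ≤ α) :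
    IsQStieltjesMoment (signlessLaguerreReciprocal α) := by
  rw [signlessLaguerreReciprocal_eq_eval_homLaguerre]
  exact minorsMem_hankel_eval_homLaguerre nonnegCoeffs.one_mem X_mem_nonnegCoeffs
    (nonnegCoeffs.mul_mem X_mem_nonnegCoeffs (C_mem_nonnegCoeffs (by linarith)))

end Laguerre

section HankelDet

variable {R : Type*} [CommRing R]

/-- The Hankel determinant `det [a (n + i + j)]` of order `k`, which turns the iterates of the
log-convexity operator into polynomials in minors of the Hankel matrix of `a`. -/
def hankelDet (a : ℕ → R) (k n : ℕ) : R :=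
  (Matrix.of fun i j : Fin k => a (n + i + j)).det

theorem hankelDet_two (a : ℕ → R) (n : ℕ) :
    hankelDet a 2 n = a n * a (n + 2) - a (n + 1) ^ 2 := by
  simp [hankelDet, Matrix.det_fin_two, sq]

theorem hankelDet_three (a : ℕ → R) (n : ℕ) :
    hankelDet a 3 n = a n * a (n + 2) * a (n + 4) + 2 * (a (n + 1) * a (n + 2) * a (n + 3)) -
      a (n + 2) ^ 3 - a n * a (n + 3) ^ 2 - a (n + 1) ^ 2 * a (n + 4) := by
  simp only [hankelDet, Matrix.det_fin_three, Matrix.of_apply, add_assoc]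
  norm_num
  ring

-- Desnanot–Jacobi condensation of the Hankel determinant of order four.
theorem hankelDet_three_mul_sub_sq (a : ℕ → R) (n : ℕ) :
    hankelDet a 3 n * hankelDet a 3 (n + 2) - hankelDet a 3 (n + 1) ^ 2 =
      hankelDet a 4 n * hankelDet a 2 (n + 2) := by
  simp only [hankelDet_three, hankelDet_two, add_assoc, Nat.reduceAdd]
  rw [hankelDet]
  simp only [Matrix.det_succ_row_zero (n := 3), Matrix.det_fin_three, Matrix.of_apply,
    Matrix.submatrix_apply, Fin.sum_univ_four, Fin.succAbove]
  norm_num [Fin.lt_def, Fin.ext_iff, add_assoc]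
  ring

theorem logConvexOp_eq_hankelDet_two (a : ℕ → ℝ[X]) : logConvexOp a = hankelDet a 2 := by
  ext1 n
  rw [hankelDet_two, logConvexOp]

theorem logConvexOp_iterate_two (a : ℕ → ℝ[X]) (n : ℕ) :
    logConvexOp^[2] a n = a (n + 2) * hankelDet a 3 n := by
  simp only [Function.iterate_succ_apply, Function.iterate_zero_apply, logConvexOp, hankelDet_three,
    add_assoc, Nat.reduceAdd]
  ring

theorem logConvexOp_iterate_three (a : ℕ → ℝ[X]) (n : ℕ) :
    logConvexOp^[3] a n =
      hankelDet a 2 (n + 2) * (hankelDet a 3 n * hankelDet a 3 (n + 2)) +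
      a (n + 3) ^ 2 * (hankelDet a 4 n * hankelDet a 2 (n + 2)) := by
  rw [← hankelDet_three_mul_sub_sq, hankelDet_two, Function.iterate_succ_apply', logConvexOp]
  simp only [logConvexOp_iterate_two]
  ring

theorem IsQStieltjesMoment.hankelDet_mem {a : ℕ → ℝ[X]} (ha : IsQStieltjesMoment a) (k n : ℕ) :
    hankelDet a k n ∈ nonnegCoeffs :=
  ha k (fun i => n + i) (fun j => j) (fun _ _ hij => Nat.add_lt_add_left hij n) fun _ _ hij => hij

theorem IsQStieltjesMoment.isIteratedQLogConvex_three {a : ℕ → ℝ[X]} (ha : IsQStieltjesMoment a) :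
    IsIteratedQLogConvex 3 a := by
  have hmem (n : ℕ) : a n ∈ nonnegCoeffs := by simpa [hankelDet] using ha.hankelDet_mem 1 n
  intro m hm n
  change logConvexOp^[m] a n ∈ nonnegCoeffs
  interval_cases m
  · exact hmem n
  · rw [Function.iterate_one, logConvexOp_eq_hankelDet_two]
    exact ha.hankelDet_mem 2 n
  · rw [logConvexOp_iterate_two]
    exact mul_mem (hmem _) (ha.hankelDet_mem 3 n)
  · rw [logConvexOp_iterate_three]
    exact add_mem (mul_mem (ha.hankelDet_mem 2 _) (mul_mem (ha.hankelDet_mem 3 _)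
      (ha.hankelDet_mem 3 _))) (mul_mem (pow_mem (hmem _) 2) (mul_mem (ha.hankelDet_mem 4 _)
      (ha.hankelDet_mem 2 _)))

end HankelDet

section Moments

open ProbabilityTheory
open scoped ENNReal NNReal

theorem isStieltjesMoment_iff_exists_lintegral {a : ℕ → ℝ} :
    IsStieltjesMoment a ↔ (∀ n, 0 ≤ a n) ∧
      ∃ μ : Measure ℝ≥0, ∀ n : ℕ, ∫⁻ x, (x : ℝ≥0∞) ^ n ∂μ = ENNReal.ofReal (a n) := by
  constructor
  · rintro ⟨μ, hμ, hmoment⟩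
    have hnonneg : ∀ᵐ x ∂μ, 0 ≤ x := by simpa [ae_iff, Set.Iio] using hμ
    have hpow (n : ℕ) : 0 ≤ᵐ[μ] fun x : ℝ => x ^ n := hnonneg.mono fun x hx => pow_nonneg hx n
    refine ⟨fun n => ?_, μ.map Real.toNNReal, fun n => ?_⟩
    · rw [(hmoment n).2]
      exact integral_nonneg_of_ae (hpow n)
    · rw [(hmoment n).2, ofReal_integral_eq_lintegral_ofReal (hmoment n).1 (hpow n),
        lintegral_map (by fun_prop) measurable_real_toNNReal]
      exact lintegral_congr_ae (hnonneg.mono fun x hx => (ENNReal.ofReal_pow hx n).symm)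
  · rintro ⟨ha, μ, hμ⟩
    have hcoe (n : ℕ) (x : ℝ≥0) : ENNReal.ofReal ((x : ℝ) ^ n) = (x : ℝ≥0∞) ^ n := by
      rw [ENNReal.ofReal_pow x.coe_nonneg, ENNReal.ofReal_coe_nnreal]
    have hpow (n : ℕ) : 0 ≤ᵐ[μ] fun x : ℝ≥0 => (x : ℝ) ^ n := .of_forall fun x => by positivity
    have hmeas : Measurable ((↑) : ℝ≥0 → ℝ) := measurable_subtype_coe
    refine ⟨μ.map (↑), ?_, fun n => ⟨?_, ?_⟩⟩
    · simp [Measure.map_apply hmeas measurableSet_Iio, Set.preimage, not_lt.mpr]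
    · rw [integrable_map_measure (by fun_prop) hmeas.aemeasurable]
      refine ⟨by fun_prop, ?_⟩
      rw [Function.comp_def, hasFiniteIntegral_iff_ofReal (hpow n)]
      simp only [hcoe, hμ, ENNReal.ofReal_lt_top]
    · rw [integral_map hmeas.aemeasurable (by fun_prop),
        integral_eq_lintegral_of_nonneg_ae (hpow n) (by fun_prop)]
      simp only [hcoe, hμ, ENNReal.toReal_ofReal (ha n)]

theorem lintegral_poissonMeasure (r : ℝ≥0) (f : ℕ → ℝ≥0∞) :
    ∫⁻ N, f N ∂poissonMeasure r = ∑' N : ℕ, ENNReal.ofReal (Real.exp (-r) * r ^ N / N !) * f N := by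
  simp [poissonMeasure, lintegral_sum_measure, lintegral_smul_measure]

theorem lintegral_descFactorial_poissonMeasure (r : ℝ≥0) (k : ℕ) :
    ∫⁻ N, (N.descFactorial k : ℝ≥0∞) ∂poissonMeasure r = (r : ℝ≥0∞) ^ k := by
  have hshift (N : ℕ) : ENNReal.ofReal (Real.exp (-r) * r ^ (N + k) / (N + k)!) *
      ((N + k).descFactorial k : ℝ≥0∞) =
      (r : ℝ≥0∞) ^ k * ENNReal.ofReal (Real.exp (-r) * r ^ N / N !) := by
    have hfactorial : ((N + k)! : ℝ) = N ! * (N + k).descFactorial k := by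
      rw [← Nat.factorial_mul_descFactorial (Nat.le_add_left k N), Nat.add_sub_cancel, Nat.cast_mul]
    have hpos : 0 < ((N + k).descFactorial k : ℝ) :=
      Nat.cast_pos.mpr (Nat.descFactorial_pos.mpr (Nat.le_add_left k N))
    rw [← ENNReal.ofReal_natCast, ← ENNReal.ofReal_mul' hpos.le, ← ENNReal.ofReal_coe_nnreal,
      ← ENNReal.ofReal_pow r.coe_nonneg, ← ENNReal.ofReal_mul (by positivity), hfactorial]
    congr 1
    field_simp
    ring
  have htotal : ∑' N : ℕ, ENNReal.ofReal (Real.exp (-r) * r ^ N / N !) = 1 := by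
    simpa using (lintegral_poissonMeasure r 1).symm
  rw [lintegral_poissonMeasure, ← ENNReal.summable.sum_add_tsum_nat_add' (k := k),
    Finset.sum_eq_zero fun N hN => ?_, zero_add]
  · simp only [hshift, ENNReal.tsum_mul_left, htotal, mul_one]
  · rw [Nat.descFactorial_eq_zero_iff_lt.mpr (Finset.mem_range.mp hN), Nat.cast_zero, mul_zero]

theorem measurable_poissonMeasure : Measurable poissonMeasure := by
  refine Measure.measurable_of_measurable_coe _ fun s hs => ?_
  simp only [← lintegral_indicator_one hs, lintegral_poissonMeasure]
  fun_prop

theorem Gamma_add_natCast {a : ℝ} (ha : 0 < a) (n : ℕ) :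
    Real.Gamma (a + n) = (∏ i ∈ Finset.range n, (a + i)) * Real.Gamma a := by
  induction n with
  | zero => simp
  | succ n ih =>
    rw [Nat.cast_succ, ← add_assoc, Real.Gamma_add_one (by positivity), ih, Finset.prod_range_succ]
    ring

theorem gammaPDF_mul_ofReal_pow {a r : ℝ} (ha : 0 < a) (hr : 0 < r) (n : ℕ) {u : ℝ} (hu : u ≠ 0) :
    gammaPDF a r u * ENNReal.ofReal u ^ n =
      ENNReal.ofReal ((∏ i ∈ Finset.range n, (a + i)) / r ^ n) * gammaPDF (a + n) r u := by
  obtain hneg | hpos := hu.lt_or_gt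
  · simp [gammaPDF_of_neg hneg]
  · have : 0 < ∏ i ∈ Finset.range n, (a + i) := Finset.prod_pos fun i _ => by positivity
    have := Real.Gamma_pos_of_pos ha
    rw [gammaPDF_of_nonneg hpos.le, gammaPDF_of_nonneg hpos.le, ← ENNReal.ofReal_pow hpos.le,
      ← ENNReal.ofReal_mul' (by positivity), ← ENNReal.ofReal_mul (by positivity),
      Gamma_add_natCast ha, add_sub_right_comm, Real.rpow_add_natCast hpos.ne',
      Real.rpow_add_natCast hr.ne']
    congr 1
    field_simp

theorem lintegral_pow_gammaMeasure {a r : ℝ} (ha : 0 < a) (hr : 0 < r) (n : ℕ) :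
    ∫⁻ u, ENNReal.ofReal u ^ n ∂gammaMeasure a r =
      ENNReal.ofReal ((∏ i ∈ Finset.range n, (a + i)) / r ^ n) := by
  have hmeas (b : ℝ) : Measurable (gammaPDF b r) := (measurable_gammaPDFReal b r).ennreal_ofReal
  have hshift : (gammaPDF a r * fun u : ℝ => ENNReal.ofReal u ^ n) =ᵐ[volume] fun u =>
      ENNReal.ofReal ((∏ i ∈ Finset.range n, (a + i)) / r ^ n) * gammaPDF (a + n) r u :=
    (Measure.ae_ne volume 0).mono fun u hu => gammaPDF_mul_ofReal_pow ha hr n hu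
  rw [gammaMeasure, lintegral_withDensity_eq_lintegral_mul _ (hmeas a) (by fun_prop),
    lintegral_congr_ae hshift, lintegral_const_mul _ (hmeas _),
    lintegral_gammaPDF_eq_one (by positivity) hr, mul_one]

theorem isStieltjesMoment_prod_range_add {a : ℝ} (ha : 0 ≤ a) :
    IsStieltjesMoment fun n => ∏ i ∈ Finset.range n, (a + i) := by
  refine isStieltjesMoment_iff_exists_lintegral.mpr
    ⟨fun n => Finset.prod_nonneg fun i _ => by positivity, ?_⟩
  obtain rfl | hpos := ha.eq_or_lt
  · refine ⟨Measure.dirac 0, fun n => ?_⟩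
    rw [lintegral_dirac]
    cases n <;> simp [Finset.prod_range_succ']
  · refine ⟨(gammaMeasure a 1).map Real.toNNReal, fun n => ?_⟩
    rw [lintegral_map (by fun_prop) measurable_real_toNNReal]
    exact (lintegral_pow_gammaMeasure hpos one_pos n).trans (by rw [one_pow, div_one])

theorem prod_range_add_eq_sum_laguerreTriangle (α : ℝ) (N n : ℕ) :
    ∏ i ∈ Finset.range n, (α + 1 + N + i) =
      ∑ k ∈ Finset.range (n + 1), laguerreTriangle α n k * N.descFactorial k := by
  have hchoose : ∏ i ∈ Finset.range n, (α + 1 + N + i) = n ! * Ring.choose (N + (n + α)) n := by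
    rw [ring_choose_real_eq, mul_div_cancel₀ _ (by positivity), ← Finset.prod_range_reflect]
    refine Finset.prod_congr rfl fun i hi => ?_
    have hreflect : n - 1 - i + (i + 1) = n := by
      have := Finset.mem_range.mp hi
      omega
    have hcast := congrArg (Nat.cast (R := ℝ)) hreflect
    push_cast at hcast ⊢
    linarith
  rw [hchoose, Ring.add_choose_eq n (Commute.all _ _),
    Finset.Nat.sum_antidiagonal_eq_sum_range_succ_mk, Finset.mul_sum]
  refine Finset.sum_congr rfl fun k hk => ?_
  rw [laguerreTriangle, if_pos (Finset.mem_range_succ_iff.mp hk), Ring.choose_natCast,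
    Nat.descFactorial_eq_factorial_mul_choose]
  push_cast
  field_simp

theorem exists_kernel_lintegral_pow_eq_sum_laguerreTriangle {α : ℝ} (hα : -1 ≤ α) :
    ∃ η : Kernel ℝ≥0 ℝ≥0, ∀ (r : ℝ≥0) (n : ℕ), ∫⁻ x, (x : ℝ≥0∞) ^ n ∂η r =
      ∑ k ∈ Finset.range (n + 1), ENNReal.ofReal (laguerreTriangle α n k) * (r : ℝ≥0∞) ^ k := by
  have hgamma (N : ℕ) : IsStieltjesMoment fun n => ∏ i ∈ Finset.range n, (α + 1 + N + i) :=
    isStieltjesMoment_prod_range_add (by linarith [N.cast_nonneg (α := ℝ)])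
  choose γ hγ using fun N => (isStieltjesMoment_iff_exists_lintegral.mp (hgamma N)).2
  have hmixture (N n : ℕ) : ∫⁻ x, (x : ℝ≥0∞) ^ n ∂γ N =
      ∑ k ∈ Finset.range (n + 1), ENNReal.ofReal (laguerreTriangle α n k) * N.descFactorial k := by
    have hnonneg := laguerreTriangle_nonneg hα
    rw [hγ, prod_range_add_eq_sum_laguerreTriangle,
      ENNReal.ofReal_sum_of_nonneg fun k _ => mul_nonneg (hnonneg n k) (Nat.cast_nonneg _)]
    simp only [ENNReal.ofReal_mul (hnonneg _ _), ENNReal.ofReal_natCast]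
  let poisson : Kernel ℝ≥0 ℕ := ⟨poissonMeasure, measurable_poissonMeasure⟩
  refine ⟨Kernel.ofFunOfCountable γ ∘ₖ poisson, fun r n => ?_⟩
  rw [Kernel.lintegral_comp _ _ _ (by fun_prop)]
  change ∫⁻ N, ∫⁻ x, (x : ℝ≥0∞) ^ n ∂γ N ∂poissonMeasure r = _
  simp only [hmixture]
  rw [lintegral_finsetSum _ fun k _ => by fun_prop]
  refine Finset.sum_congr rfl fun k _ => ?_
  rw [lintegral_const_mul _ (by fun_prop), lintegral_descFactorial_poissonMeasure]

-- The value `s` at `t = 0` is the limit of `t * x` in law as `t → 0`: an atom of the second measure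
-- at the origin contributes to the moments.
theorem lintegral_pow_homogenize {A : ℕ → ℕ → ℝ} (hdiag : ∀ n, A n n = 1)
    {η : Kernel ℝ≥0 ℝ≥0} [IsMarkovKernel η] (hη : ∀ (r : ℝ≥0) (n : ℕ), ∫⁻ x, (x : ℝ≥0∞) ^ n ∂η r =
      ∑ k ∈ Finset.range (n + 1), ENNReal.ofReal (A n k) * (r : ℝ≥0∞) ^ k) (s t : ℝ≥0) (n : ℕ) :
    ∫⁻ x, ((if t = 0 then s else t * x : ℝ≥0) : ℝ≥0∞) ^ n ∂η (s / t) =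
      ∑ k ∈ Finset.range (n + 1),
        ENNReal.ofReal (A n k) * ((s : ℝ≥0∞) ^ k * (t : ℝ≥0∞) ^ (n - k)) := by
  obtain rfl | ht := eq_or_ne t 0
  · rw [Finset.sum_range_succ, Finset.sum_eq_zero fun k hk => ?_]
    · simp [hdiag]
    · rw [ENNReal.coe_zero, zero_pow (Nat.sub_pos_of_lt (Finset.mem_range.mp hk)).ne']
      simp
  · simp only [if_neg ht, ENNReal.coe_mul, mul_pow]
    rw [lintegral_const_mul _ (by fun_prop), hη, Finset.mul_sum]
    refine Finset.sum_congr rfl fun k hk => ?_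
    have hcancel : t ^ n * (s / t) ^ k = s ^ k * t ^ (n - k) := by
      rw [← pow_sub_mul_pow t (Finset.mem_range_succ_iff.mp hk), div_pow]
      field_simp
    rw [mul_left_comm]
    exact_mod_cast congrArg (fun u : ℝ≥0 => ENNReal.ofReal (A n k) * u) hcancel

theorem preservesStieltjesMoment_of_kernel {A : ℕ → ℕ → ℝ} (hA : ∀ n k, 0 ≤ A n k)
    (hdiag : ∀ n, A n n = 1) {η : Kernel ℝ≥0 ℝ≥0} (hη : ∀ (r : ℝ≥0) (n : ℕ),
      ∫⁻ x, (x : ℝ≥0∞) ^ n ∂η r =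
        ∑ k ∈ Finset.range (n + 1), ENNReal.ofReal (A n k) * (r : ℝ≥0∞) ^ k) :
    PreservesStieltjesMoment A := by
  intro x y hx hy
  obtain ⟨hx0, μ, hμ⟩ := isStieltjesMoment_iff_exists_lintegral.mp hx
  obtain ⟨hy0, ν, hν⟩ := isStieltjesMoment_iff_exists_lintegral.mp hy
  have hterm (n k : ℕ) : 0 ≤ A n k * x k * y (n - k) :=
    mul_nonneg (mul_nonneg (hA n k) (hx0 k)) (hy0 (n - k))
  have : IsFiniteMeasure μ := ⟨by simpa using (hμ 0).trans_lt ENNReal.ofReal_lt_top⟩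
  have : IsFiniteMeasure ν := ⟨by simpa using (hν 0).trans_lt ENNReal.ofReal_lt_top⟩
  have : IsMarkovKernel η := ⟨fun r => ⟨by simpa [hdiag] using hη r 0⟩⟩
  let ratio : ℝ≥0 × ℝ≥0 → ℝ≥0 := fun p => p.1 / p.2
  have hratio : Measurable ratio := by fun_prop
  let scale : (ℝ≥0 × ℝ≥0) × ℝ≥0 → ℝ≥0 := fun q => if q.1.2 = 0 then q.1.1 else q.1.2 * q.2
  have hscale : Measurable scale :=
    Measurable.ite (measurable_snd.comp measurable_fst (measurableSet_singleton 0)) (by fun_prop)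
      (by fun_prop)
  refine isStieltjesMoment_iff_exists_lintegral.mpr ⟨fun n => Finset.sum_nonneg fun k _ =>
    hterm n k, ((μ.prod ν).compProd (η.comap ratio hratio)).map scale, fun n => ?_⟩
  rw [lintegral_map (by fun_prop) hscale, Measure.lintegral_compProd (by fun_prop)]
  simp only [Kernel.comap_apply, scale, ratio, lintegral_pow_homogenize hdiag hη]
  rw [lintegral_finsetSum _ fun k _ => by fun_prop, triangularConvolution,
    ENNReal.ofReal_sum_of_nonneg fun k _ => hterm n k]
  refine Finset.sum_congr rfl fun k _ => ?_
  rw [lintegral_const_mul _ (by fun_prop), lintegral_prod_mul (f := fun s : ℝ≥0 => (s : ℝ≥0∞) ^ k)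
    (g := fun t : ℝ≥0 => (t : ℝ≥0∞) ^ (n - k)) (by fun_prop) (by fun_prop), hμ, hν, mul_assoc,
    ENNReal.ofReal_mul (hA n k), ENNReal.ofReal_mul (hx0 k)]

theorem preservesStieltjesMoment_laguerreTriangle {α : ℝ} (hα : -1 ≤ α) :
    PreservesStieltjesMoment (laguerreTriangle α) := by
  obtain ⟨η, hη⟩ := exists_kernel_lintegral_pow_eq_sum_laguerreTriangle hα
  exact preservesStieltjesMoment_of_kernel (laguerreTriangle_nonneg hα) (laguerreTriangle_self α) hη

end Moments

theorem mainTheorem9 (α : ℝ) (hα : -1 ≤ α) :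
    (IsQStieltjesMoment (signlessLaguerrePoly α) ∧
      IsIteratedQLogConvex 3 (signlessLaguerrePoly α) ∧
      IsQStieltjesMoment (signlessLaguerreReciprocal α) ∧
      IsIteratedQLogConvex 3 (signlessLaguerreReciprocal α)) ∧
    IsTotallyPositive (laguerreTriangle α) ∧
    PreservesStieltjesMoment (laguerreTriangle α) := by
  have hpoly := isQStieltjesMoment_signlessLaguerrePoly hα
  have hreciprocal := isQStieltjesMoment_signlessLaguerreReciprocal hα
  exact ⟨⟨hpoly, hpoly.isIteratedQLogConvex_three, hreciprocal,
    hreciprocal.isIteratedQLogConvex_three⟩, isTotallyPositive_laguerreTriangle hα,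
    preservesStieltjesMoment_laguerreTriangle hα⟩
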